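/- Let $X=(X_n)_{n\ge 0}$ be a one-dimensional random walk started from $X_0=0$ (its increments are independent and all distributed as $X_1$), and assume that $X_1$ is not identically zero, i.e. $\mathbb{P}(X_1=0)<1$. Adjoin a cemetery state $\Delta$ to $\mathbb{R}$, and extend every function $f\colon\mathbb{R}\to\mathbb{C}$ by $f(\Delta)=0$; a defective random variable is a random variable with values in $\mathbb{R}\cup\{\Delta\}$, and it is called positive (non-negative) if almost surely it takes values in $(0,\infty)\cup\{\Delta\}$ (in $[0,\infty)\cup\{\Delta\}$). Let \[ \tau^+=\inf\{n\ge 1: X_n>0\},\qquad \tau^{-,w}=\inf\{n\ge 1: X_n\le 0\}. \] Let the first strict ascending ladder height $H^+$ be $X_{\tau^+}$ on $\{\tau^+<\infty\}$ and $\Delta$ otherwise, and let the first weak descending ladder height $H^{-,w}$ be $-X_{\tau^{-,w}}$ on $\{\tau^{-,w}<\infty\}$ and $\Delta$ otherwise. If $V^+$ is a positive defective random variable and $V^-$ is a non-negative defective random variable such that \[ 1-\mathbb{E}\big[e^{izX_1}\big]=\Big(1-\mathbb{E}\big[e^{izV^+}\big]\Big)\Big(1-\mathbb{E}\big[e^{-izV^-}\big]\Big)\qquad\text{for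 all } z\in\mathbb{R}, \] then $V^+\overset{d}{=}H^+$ and $V^-\overset{d}{=}H^{-,w}$. -/

import Mathlib

open MeasureTheory ProbabilityTheory

noncomputable section

/-- The `σ`-algebra on `α ∪ {Δ}`, where the cemetery state `Δ` is `none`: a set is measurable
if and only if its trace on `α` is measurable. -/
instance Option.cemeteryMeasurableSpace {α : Type*} [m : MeasurableSpace α] :
    MeasurableSpace (Option α) :=
  MeasurableSpace.map some m

/-- The extension of `f : ℝ → ℂ` to `ℝ ∪ {Δ}` by `f Δ = 0`. -/
def extendByZero (f : ℝ → ℂ) : Option ℝ → ℂ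
  | none => 0
  | some x => f x

/-- `𝔼[exp (i z V)]` for a defective random variable `V`, with the convention `exp (i z Δ) = 0`. -/
def defectiveCharFun {Ω : Type*} [MeasurableSpace Ω] (P : Measure Ω) (V : Ω → Option ℝ) (z : ℝ) :
    ℂ :=
  ∫ ω, extendByZero (fun x => Complex.exp (Complex.I * (z : ℂ) * (x : ℂ))) (V ω) ∂P

/-- `X` is a one-dimensional random walk started from `0`: a real process with independent
increments, each of which is distributed as the step `X 1`. -/
structure IsRandomWalk {Ω : Type*} [MeasurableSpace Ω] (P : Measure Ω) (X : ℕ → Ω → ℝ) :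
    Prop where
  measurable : ∀ n, Measurable (X n)
  zero : ∀ᵐ ω ∂P, X 0 ω = 0
  indep : iIndepFun (fun n ω => X (n + 1) ω - X n ω) P
  identDistrib : ∀ n, IdentDistrib (fun ω => X (n + 1) ω - X n ω) (X 1) P P

/-- `τ⁺ = inf {n ≥ 1 : X n > 0}`, with value `⊤` if there is no such `n`. -/
def strictAscendingTime {Ω : Type*} (X : ℕ → Ω → ℝ) : Ω → WithTop ℕ :=
  hittingAfter X (Set.Ioi 0) 1

/-- `τ⁻ʷ = inf {n ≥ 1 : X n ≤ 0}`, with value `⊤` if there is no such `n`. -/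
def weakDescendingTime {Ω : Type*} (X : ℕ → Ω → ℝ) : Ω → WithTop ℕ :=
  hittingAfter X (Set.Iic 0) 1

open scoped Classical in
/-- The first strict ascending ladder height: `X` at time `τ⁺` if `τ⁺ < ∞`, and `Δ` otherwise. -/
def strictAscendingHeight {Ω : Type*} (X : ℕ → Ω → ℝ) : Ω → Option ℝ := fun ω =>
  if strictAscendingTime X ω = ⊤ then none else some (stoppedValue X (strictAscendingTime X) ω)

open scoped Classical in
/-- The first weak descending ladder height: the depth `-X ≥ 0` at time `τ⁻ʷ` if `τ⁻ʷ < ∞`,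
and `Δ` otherwise. -/
def weakDescendingHeight {Ω : Type*} (X : ℕ → Ω → ℝ) : Ω → Option ℝ := fun ω =>
  if weakDescendingTime X ω = ⊤ then none else some (-stoppedValue X (weakDescendingTime X) ω)

end

/-!
The factorization says that `μ + ν ∗ ν' = ν + ν'`, where `μ` is the step law, `ν` the law of `V⁺`
on `(0, ∞)` and `ν'` the law of `-V⁻` on `(-∞, 0]`, both without their mass at `Δ`. The laws `η` and
`η'` of the positions at which the walk first exits `(-∞, 0]` and `(0, ∞)` solve the same equation,
and uniqueness rests on two facts: they are the smallest solution, and one of them has mass one.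

Existence (`exitLaw_add_exitLaw_compl`) is proved with formal power series in a variable `q` marking
time. For a half-line `s`, let `K_s` be the generating function of the laws of the walk killed on
leaving `s`, and `E_s` that of its exit laws, both taken through characteristic functions. A step
gives `K_s (1 - q μ̂) = 1 - E_s`. Hence `K_s (1 - E_{sᶜ}) = K_{sᶜ} (1 - E_s)`, where the two sides
are carried, up to the constant term `1`, by complementary half-lines; both are therefore `1`, and
`(1 - E_s) (1 - E_{sᶜ}) = 1 - q μ̂` follows.

Minimality (`totalExitLaw_le`): if the partial sums of the exit laws up to time `N` are at most `ν`
and `ν'`, then the identity bounds the sum of the next two by `μ + ν ∗ ν' = ν + ν'`, and restricting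
to each half-line gives the bounds for `N + 1`.

Uniqueness (`eq_totalExitLaw`): taking masses in `μ + η ∗ η' = η + η'` shows that `η` or `η'` has
mass one, so it equals the factor that dominates it. The difference `θ ≥ 0` of the other two factors
satisfies `θ = η ∗ θ` or `θ = η' ∗ θ`. A finite measure that is invariant under random translations
in one direction, not all trivial, is zero (`eq_zero_of_conv_eq_self`); triviality is excluded
because `η' = δ₀` would force `μ = δ₀`.
-/

open Finset.HasAntidiagonal (antidiagonal)

/-! ### Finite measures, convolution and characteristic functions -/

theorem MeasureTheory.Measure.add_left_cancel_of_isFinite {α : Type*}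
    [MeasurableSpace α] {m ν ρ : Measure α} [IsFiniteMeasure m] (h : m + ν = m + ρ) : ν = ρ := by
  ext s _
  have := congrArg (fun k : Measure α => k s) h
  simpa using this

theorem charFun_add_measure (m k : Measure ℝ) [IsFiniteMeasure m] [IsFiniteMeasure k] :
    charFun (m + k) = charFun m + charFun k := by
  ext t
  simp only [charFun_eq_integral_innerProbChar, Pi.add_apply]
  exact integral_add_measure (BoundedContinuousFunction.integrable _ _)
    (BoundedContinuousFunction.integrable _ _)

theorem charFun_conv_eq_mul (m k : Measure ℝ) [IsFiniteMeasure m] [IsFiniteMeasure k] :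
    charFun (m ∗ k) = charFun m * charFun k :=
  funext fun t => charFun_conv t

theorem charFun_dirac_zero : charFun (Measure.dirac (0 : ℝ)) = 1 := by
  ext t; simp

theorem charFun_sum_measure {ι : Type*} (s : Finset ι) (m : ι → Measure ℝ)
    [∀ i, IsFiniteMeasure (m i)] :
    charFun (∑ i ∈ s, m i) = ∑ i ∈ s, charFun (m i) := by
  classical
  induction s using Finset.induction_on with
  | empty => ext t; simp
  | insert a s ha ih => rw [Finset.sum_insert ha, Finset.sum_insert ha, charFun_add_measure, ih]

/-- A convolution puts no mass on `u` when no point of `u` is a sum of a point off the null set `s`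
and a point off the null set `t`. -/
theorem conv_apply_eq_zero {m k : Measure ℝ} [SFinite m] [SFinite k] {s t u : Set ℝ}
    (hu : MeasurableSet u)
    (hm : m s = 0) (hk : k t = 0) (h : ∀ x ∉ s, ∀ y ∉ t, x + y ∉ u) : (m ∗ k) u = 0 := by
  have hx : ∀ᵐ x ∂m, x ∉ s := measure_eq_zero_iff_ae_notMem.1 hm
  have hy : ∀ᵐ y ∂k, y ∉ t := measure_eq_zero_iff_ae_notMem.1 hk
  rw [← lintegral_indicator_one hu, Measure.lintegral_conv (by measurability)]
  refine (lintegral_congr_ae (g := 0) ?_).trans (by simp)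
  filter_upwards [hx] with x hx
  refine (lintegral_congr_ae (g := 0) ?_).trans (by simp)
  filter_upwards [hy] with y hy
  simp [h x hx y hy]

theorem conv_mono {m m' k k' : Measure ℝ} [SFinite m] [SFinite m'] [SFinite k] [SFinite k']
    (hm : m ≤ m') (hk : k ≤ k') : m ∗ k ≤ m' ∗ k' :=
  Measure.map_mono (Measure.prod_mono hm hk) (by fun_prop)

theorem conv_apply_univ (m k : Measure ℝ) [SFinite m] [SFinite k] :
    (m ∗ k) Set.univ = m Set.univ * k Set.univ := by
  rw [Measure.conv, Measure.map_apply (by fun_prop) MeasurableSet.univ, Set.preimage_univ,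
    ← Set.univ_prod_univ, Measure.prod_prod]

/-- The Cauchy product formula for convolutions of series of measures. -/
theorem sum_conv_sum (m k : ℕ → Measure ℝ) [∀ i, SFinite (m i)] [∀ i, SFinite (k i)] :
    Measure.sum m ∗ Measure.sum k =
      Measure.sum fun n => ∑ p ∈ antidiagonal n, m p.1 ∗ k p.2 := by
  rw [Measure.conv, Measure.prod_sum, Measure.map_sum (by fun_prop)]
  ext s hs
  rw [Measure.sum_apply _ hs, Measure.sum_apply _ hs,
    ← Finset.HasAntidiagonal.sigmaAntidiagonalEquivProd.tsum_eq, ENNReal.tsum_sigma']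
  refine tsum_congr fun n => ?_
  rw [Measure.finsetSum_apply, ← Finset.tsum_subtype]
  rfl

/-- The characteristic functions of the finite signed measures carried by `s`, each
written as a difference of two finite measures. -/
def signedCharFun (s : Set ℝ) : AddSubgroup (ℝ → ℂ) where
  carrier := {a | ∃ m k : Measure ℝ, IsFiniteMeasure m ∧ IsFiniteMeasure k ∧
    m sᶜ = 0 ∧ k sᶜ = 0 ∧ a = charFun m - charFun k}
  zero_mem' := ⟨0, 0, inferInstance, inferInstance, by simp, by simp, by simp⟩
  add_mem' := by
    rintro _ _ ⟨m, k, _, _, hm, hk, rfl⟩ ⟨m', k', _, _, hm', hk', rfl⟩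
    exact ⟨m + m', k + k', inferInstance, inferInstance, by simp [hm, hm'], by simp [hk, hk'], by
      rw [charFun_add_measure, charFun_add_measure]; ring⟩
  neg_mem' := by
    rintro _ ⟨m, k, _, _, hm, hk, rfl⟩
    exact ⟨k, m, inferInstance, inferInstance, hk, hm, by ring⟩

theorem charFun_mem_signedCharFun {s : Set ℝ} {m : Measure ℝ} [IsFiniteMeasure m]
    (hm : m sᶜ = 0) : charFun m ∈ signedCharFun s :=
  ⟨m, 0, inferInstance, inferInstance, hm, by simp, by ext; simp⟩

/-- A finite signed measure carried both by `s` and by its complement is zero, expressed through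
characteristic functions. This is what makes a decomposition into parts on the two half-lines
unique. -/
theorem eq_zero_of_mem_signedCharFun_compl {s : Set ℝ} {a : ℝ → ℂ}
    (h : a ∈ signedCharFun s) (h' : a ∈ signedCharFun sᶜ) : a = 0 := by
  obtain ⟨m, k, _, _, hm, hk, rfl⟩ := h
  obtain ⟨m', k', _, _, hm', hk', h⟩ := h'
  rw [compl_compl] at hm' hk'
  have key : m + k' = m' + k := by
    apply Measure.ext_of_charFun
    rw [charFun_add_measure, charFun_add_measure]
    linear_combination h
  have : m = k := by
    ext t ht
    have := congrArg (fun j : Measure ℝ => j (t ∩ s)) key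
    simp only [Measure.add_apply, measure_mono_null Set.inter_subset_right hm',
      measure_mono_null Set.inter_subset_right hk', add_zero, zero_add] at this
    rwa [measure_inter_conull hm, measure_inter_conull hk] at this
  rw [this, sub_self]

/-! ### Killed laws and exit laws -/

/-- Law of the `n`-th position of a walk with step law `μ` started from `0`, on the event that
the positions at times `1, …, n` all lie in `s`. -/
noncomputable def killedLaw (s : Set ℝ) (μ : Measure ℝ) : ℕ → Measure ℝ
  | 0 => Measure.dirac 0
  | n + 1 => (killedLaw s μ n ∗ μ).restrict s

/-- Law of the position of a walk with step law `μ` started from `0` at its first exit from `s`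
after time `0`, on the event that this exit happens at time `n`. -/
noncomputable def exitLaw (s : Set ℝ) (μ : Measure ℝ) : ℕ → Measure ℝ
  | 0 => 0
  | n + 1 => (killedLaw s μ n ∗ μ).restrict sᶜ

instance isFiniteMeasure_killedLaw (s : Set ℝ) (μ : Measure ℝ) [IsFiniteMeasure μ] (n : ℕ) :
    IsFiniteMeasure (killedLaw s μ n) := by
  induction n with
  | zero => rw [killedLaw]; infer_instance
  | succ n ih => rw [killedLaw]; infer_instance

instance isFiniteMeasure_exitLaw (s : Set ℝ) (μ : Measure ℝ) [IsFiniteMeasure μ] (n : ℕ) :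
    IsFiniteMeasure (exitLaw s μ n) := by
  cases n <;> rw [exitLaw] <;> infer_instance

theorem exitLaw_apply_self (μ : Measure ℝ) {s : Set ℝ} (hs : MeasurableSet s) (n : ℕ) :
    exitLaw s μ n s = 0 := by
  cases n with
  | zero => simp [exitLaw]
  | succ n => rw [exitLaw, Measure.restrict_apply hs]; simp

theorem killedLaw_succ_apply_compl (μ : Measure ℝ) {s : Set ℝ} (hs : MeasurableSet s) (n : ℕ) :
    killedLaw s μ (n + 1) sᶜ = 0 := by
  rw [killedLaw, Measure.restrict_apply hs.compl]; simp

theorem killedLaw_succ_add_exitLaw_succ (μ : Measure ℝ) {s : Set ℝ} (hs : MeasurableSet s)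
    (n : ℕ) :
    killedLaw s μ (n + 1) + exitLaw s μ (n + 1) = killedLaw s μ n ∗ μ :=
  Measure.restrict_add_restrict_compl hs

open PowerSeries in
/-- One step of the walk either survives in `s` or exits: with `q` the power series variable,
the generating functions satisfy `K(q) (1 - q μ̂) = 1 - E(q)`. -/
theorem mk_killedLaw_mul (μ : Measure ℝ) [IsFiniteMeasure μ] {s : Set ℝ} (hs : MeasurableSet s) :
    mk (fun n => charFun (killedLaw s μ n)) * (1 - C (charFun μ) * X) =
      1 - mk (fun n => charFun (exitLaw s μ n)) := by
  ext1 n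
  rw [mul_sub, mul_one, ← mul_assoc, mul_comm _ (C _), mul_assoc, map_sub, map_sub,
    coeff_C_mul, coeff_mk, coeff_mk]
  cases n with
  | zero =>
    have : charFun (0 : Measure ℝ) = 0 := by ext; simp
    simp [killedLaw, exitLaw, charFun_dirac_zero, this]
  | succ n =>
    have := congrArg charFun (killedLaw_succ_add_exitLaw_succ μ hs n)
    rw [charFun_add_measure, charFun_conv_eq_mul] at this
    rw [coeff_succ_mul_X, coeff_mk, coeff_one, if_neg n.succ_ne_zero]
    linear_combination this

/-! ### The Wiener–Hopf factorization of the exit laws -/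

theorem mul_mem_signedCharFun {s : Set ℝ} (hs : MeasurableSet s)
    (hadd : ∀ x ∈ s, ∀ y ∈ s, x + y ∈ s) {a b : ℝ → ℂ}
    (ha : a ∈ signedCharFun s) (hb : b ∈ signedCharFun s) : a * b ∈ signedCharFun s := by
  obtain ⟨m, k, _, _, hm, hk, rfl⟩ := ha
  obtain ⟨m', k', _, _, hm', hk', rfl⟩ := hb
  have key {i j : Measure ℝ} [IsFiniteMeasure i] [IsFiniteMeasure j] (hi : i sᶜ = 0)
      (hj : j sᶜ = 0) : (i ∗ j) sᶜ = 0 :=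
    conv_apply_eq_zero hs.compl hi hj (by simpa using hadd)
  refine ⟨m ∗ m' + k ∗ k', m ∗ k' + k ∗ m', inferInstance, inferInstance, ?_, ?_, ?_⟩
  · simp [key hm hm', key hk hk']
  · simp [key hm hk', key hk hm']
  · simp only [charFun_add_measure, charFun_conv_eq_mul]; ring

open PowerSeries in
/-- The exit law from the complement of `s` is carried by `s`, so apart from its constant term the
series `K_s (1 - E_{sᶜ})` has all its coefficients carried by the semigroup `s`. -/
theorem coeff_killedLaw_mul_mem (μ : Measure ℝ) [IsFiniteMeasure μ] {s : Set ℝ}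
    (hs : MeasurableSet s) (hadd : ∀ x ∈ s, ∀ y ∈ s, x + y ∈ s) {n : ℕ} (hn : n ≠ 0) :
    coeff n (mk (fun n => charFun (killedLaw s μ n)) *
      (1 - mk fun n => charFun (exitLaw sᶜ μ n))) ∈ signedCharFun s := by
  have hk {i : ℕ} (hi : i ≠ 0) : charFun (killedLaw s μ i) ∈ signedCharFun s := by
    obtain ⟨i, rfl⟩ := Nat.exists_eq_succ_of_ne_zero hi
    exact charFun_mem_signedCharFun (killedLaw_succ_apply_compl μ hs i)
  have he (i : ℕ) : charFun (exitLaw sᶜ μ i) ∈ signedCharFun s :=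
    charFun_mem_signedCharFun (exitLaw_apply_self μ hs.compl i)
  rw [mul_sub, mul_one, map_sub, coeff_mk, coeff_mul]
  refine sub_mem (hk hn) (sum_mem fun p _ => ?_)
  rw [coeff_mk, coeff_mk]
  rcases eq_or_ne p.1 0 with h0 | h0
  · rw [h0, killedLaw, charFun_dirac_zero, one_mul]
    exact he _
  · exact mul_mem_signedCharFun hs hadd (hk h0) (he _)

open PowerSeries in
/-- By `mk_killedLaw_mul`, both `K_s (1 - E_{sᶜ})` and `K_{sᶜ} (1 - E_s)` equal
`K_s K_{sᶜ} (1 - q μ̂)`. Their coefficients of positive order are carried by `s` and by `sᶜ`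
respectively, hence vanish. -/
theorem mk_killedLaw_mul_one_sub_mk_exitLaw (μ : Measure ℝ) [IsFiniteMeasure μ] {s : Set ℝ}
    (hs : MeasurableSet s) (hadd : ∀ x ∈ s, ∀ y ∈ s, x + y ∈ s)
    (hadd' : ∀ x ∈ sᶜ, ∀ y ∈ sᶜ, x + y ∈ sᶜ) :
    mk (fun n => charFun (killedLaw s μ n)) *
      (1 - mk fun n => charFun (exitLaw sᶜ μ n)) = 1 := by
  have hcomm : mk (fun n => charFun (killedLaw s μ n)) *
      (1 - mk fun n => charFun (exitLaw sᶜ μ n)) =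
      mk (fun n => charFun (killedLaw sᶜ μ n)) *
      (1 - mk fun n => charFun (exitLaw s μ n)) := by
    rw [← mk_killedLaw_mul μ hs, ← mk_killedLaw_mul μ hs.compl]
    ring
  ext1 n
  rcases eq_or_ne n 0 with rfl | hn
  · have : charFun (0 : Measure ℝ) = 0 := by ext; simp
    simp [coeff_mul, killedLaw, exitLaw, charFun_dirac_zero, this]
  · rw [coeff_one, if_neg hn]
    refine eq_zero_of_mem_signedCharFun_compl (coeff_killedLaw_mul_mem μ hs hadd hn) ?_
    rw [hcomm]
    have := coeff_killedLaw_mul_mem μ hs.compl hadd' hn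
    rwa [compl_compl] at this

open PowerSeries in
/-- The Wiener–Hopf factorization `(1 - E_s) (1 - E_{sᶜ}) = 1 - q μ̂`, coefficient by coefficient
and with all terms of one sign, so that it is an identity between measures. -/
theorem exitLaw_add_exitLaw_compl (μ : Measure ℝ) [IsFiniteMeasure μ] {s : Set ℝ}
    (hs : MeasurableSet s) (hadd : ∀ x ∈ s, ∀ y ∈ s, x + y ∈ s)
    (hadd' : ∀ x ∈ sᶜ, ∀ y ∈ sᶜ, x + y ∈ sᶜ) (n : ℕ) :
    exitLaw s μ n + exitLaw sᶜ μ n = (if n = 1 then μ else 0) +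
      ∑ p ∈ antidiagonal n, exitLaw s μ p.1 ∗ exitLaw sᶜ μ p.2 := by
  have key : (1 - mk fun n => charFun (exitLaw s μ n)) *
      (1 - mk fun n => charFun (exitLaw sᶜ μ n)) = 1 - C (charFun μ) * X := by
    rw [← mk_killedLaw_mul μ hs, mul_right_comm,
      mk_killedLaw_mul_one_sub_mk_exitLaw μ hs hadd hadd', one_mul]
  have h := congrArg (coeff n) (show (mk fun n => charFun (exitLaw s μ n)) +
      (mk fun n => charFun (exitLaw sᶜ μ n)) = C (charFun μ) * X +
      (mk fun n => charFun (exitLaw s μ n)) * (mk fun n => charFun (exitLaw sᶜ μ n)) by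
    linear_combination -key)
  have : IsFiniteMeasure (if n = 1 then μ else 0) := by split_ifs <;> infer_instance
  apply Measure.ext_of_charFun
  rw [map_add, map_add, coeff_C_mul, coeff_X, coeff_mul] at h
  simp only [coeff_mk] at h
  rw [charFun_add_measure, charFun_add_measure, charFun_sum_measure, h]
  congr 1
  · split_ifs
    · simp
    · ext; simp
  · simp only [charFun_conv_eq_mul]

/-! ### Invariant measures of one-sided convolutions -/

/-- A finite measure `θ` invariant under convolution with a probability measure `η ≠ δ₀` is zero if
the steps of `η` all go in one direction, in the sense that none of them decreases a bounded
injective `g`. Indeed `∫ g(y + x) θ(dx) ≥ ∫ g(x) θ(dx)` for almost all steps `y`, and invariance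
forces equality. -/
theorem eq_zero_of_conv_eq_self {η θ : Measure ℝ} [IsProbabilityMeasure η] [IsFiniteMeasure θ]
    (h : η ∗ θ = θ) (h0 : η ≠ Measure.dirac 0) {g : ℝ → ENNReal} (hg : Measurable g)
    (hinj : Function.Injective g) {C : ENNReal} (hC : C ≠ ⊤) (hgC : ∀ x, g x ≤ C)
    (hmono : ∀ᵐ y ∂η, ∀ x, g x ≤ g (y + x)) : θ = 0 := by
  have hfin : ∫⁻ x, g x ∂θ ≠ ⊤ :=
    ((lintegral_mono hgC).trans_lt ((lintegral_const C).trans_lt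
      (ENNReal.mul_lt_top hC.lt_top (measure_lt_top θ _)))).ne
  have hle : ∀ᵐ y ∂η, ∫⁻ x, g x ∂θ ≤ ∫⁻ x, g (y + x) ∂θ := by
    filter_upwards [hmono] with y hy using lintegral_mono hy
  have heq : ∀ᵐ y ∂η, ∫⁻ x, g x ∂θ = ∫⁻ x, g (y + x) ∂θ := by
    refine ae_eq_of_ae_le_of_lintegral_le hle (by simpa using hfin) ?_ ?_
    · exact (Measurable.lintegral_prod_right' (f := fun p : ℝ × ℝ => g (p.1 + p.2))
        (by fun_prop)).aemeasurable
    · rw [← Measure.lintegral_conv hg, h]; simp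
  by_contra hθ
  -- As `θ ≠ 0`, an identity holding `θ`-almost everywhere holds at some point.
  have hθ' : NeZero θ := ⟨hθ⟩
  apply h0
  have hy0 : ∀ᵐ y ∂η, y = 0 := by
    filter_upwards [hmono, heq] with y hy hyeq
    have hx := ae_eq_of_ae_le_of_lintegral_le (ae_of_all θ hy) hfin
      (hg.comp (measurable_const_add y)).aemeasurable hyeq.ge
    obtain ⟨x, hx⟩ := hx.exists
    simpa using hinj hx
  rw [← Measure.map_id (μ := η), Measure.map_congr (f := id) (g := fun _ => 0) hy0,
    Measure.map_const]
  simp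

/-- A bounded strictly increasing function with values in `[0, ∞)`. -/
noncomputable def shiftedArctan (x : ℝ) : ENNReal := ENNReal.ofReal (Real.arctan x + Real.pi / 2)

theorem strictMono_shiftedArctan : StrictMono shiftedArctan := fun x y hxy =>
  (ENNReal.ofReal_lt_ofReal_iff (by linarith [Real.neg_pi_div_two_lt_arctan y])).2
    (by linarith [Real.arctan_strictMono hxy])

theorem measurable_shiftedArctan : Measurable shiftedArctan := by
  unfold shiftedArctan; fun_prop

theorem shiftedArctan_le (x : ℝ) : shiftedArctan x ≤ ENNReal.ofReal Real.pi :=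
  ENNReal.ofReal_le_ofReal (by linarith [Real.arctan_lt_pi_div_two x])

theorem eq_zero_of_conv_eq_self_of_measure_Iio {η θ : Measure ℝ} [IsProbabilityMeasure η]
    [IsFiniteMeasure θ] (h : η ∗ θ = θ) (h0 : η ≠ Measure.dirac 0) (hη : η (Set.Iio 0) = 0) :
    θ = 0 := by
  refine eq_zero_of_conv_eq_self h h0 measurable_shiftedArctan strictMono_shiftedArctan.injective
    ENNReal.ofReal_ne_top shiftedArctan_le ?_
  filter_upwards [measure_eq_zero_iff_ae_notMem.1 hη] with y hy x
  exact strictMono_shiftedArctan.monotone (by simpa using hy)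

theorem eq_zero_of_conv_eq_self_of_measure_Ioi {η θ : Measure ℝ} [IsProbabilityMeasure η]
    [IsFiniteMeasure θ] (h : η ∗ θ = θ) (h0 : η ≠ Measure.dirac 0) (hη : η (Set.Ioi 0) = 0) :
    θ = 0 := by
  refine eq_zero_of_conv_eq_self h h0 (measurable_shiftedArctan.comp measurable_neg)
    (strictMono_shiftedArctan.injective.comp neg_injective)
    ENNReal.ofReal_ne_top (fun x => shiftedArctan_le (-x)) ?_
  filter_upwards [measure_eq_zero_iff_ae_notMem.1 hη] with y hy x
  exact strictMono_shiftedArctan.monotone (by simpa using hy)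

theorem MeasureTheory.Measure.eq_of_le_of_measure_univ_le {α : Type*}
    [MeasurableSpace α] {m k : Measure α} [IsFiniteMeasure m] (h : m ≤ k)
    (hu : k Set.univ ≤ m Set.univ) : m = k := by
  have hk := Measure.sub_add_cancel_of_le h
  have : (k - m) Set.univ = 0 := by
    have h1 := congrArg (fun j : Measure α => j Set.univ) hk
    simp only [Measure.add_apply] at h1
    rw [← h1] at hu
    have := measure_ne_top m Set.univ
    by_contra h2
    exact absurd hu (not_le.2 (by rw [add_comm]; exact ENNReal.lt_add_right this h2))
  rw [Measure.measure_univ_eq_zero.1 this, zero_add] at hk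
  exact hk

/-- Two ordered solutions of `μ + η ∗ θ = η + θ` differ by a finite measure invariant under
convolution with `η`, so they agree once such measures vanish. -/
theorem eq_of_add_conv_eq {μ η θ₁ θ₂ : Measure ℝ} [IsFiniteMeasure μ] [IsFiniteMeasure η]
    [IsFiniteMeasure θ₁] [IsFiniteMeasure θ₂] (hle : θ₁ ≤ θ₂)
    (h₁ : μ + η ∗ θ₁ = η + θ₁) (h₂ : μ + η ∗ θ₂ = η + θ₂)
    (hdrift : ∀ θ : Measure ℝ, IsFiniteMeasure θ → η ∗ θ = θ → θ = 0) : θ₁ = θ₂ := by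
  have hs := Measure.sub_add_cancel_of_le hle
  have hθ : IsFiniteMeasure (θ₂ - θ₁) := inferInstance
  generalize θ₂ - θ₁ = θ at hs hθ
  subst hs
  have : θ = 0 := by
    refine hdrift θ hθ (Measure.add_left_cancel_of_isFinite (m := η + θ₁) ?_)
    rw [Measure.conv_add, ← add_assoc, add_right_comm, h₁] at h₂
    rw [h₂]; abel
  rw [this, zero_add]

/-! ### Minimality and uniqueness -/

/-- Law of the place where the walk with step law `μ` first exits `s` after time `0`; its mass is
the probability that the exit takes place. -/
noncomputable def totalExitLaw (s : Set ℝ) (μ : Measure ℝ) : Measure ℝ :=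
  Measure.sum (exitLaw s μ)

theorem totalExitLaw_apply_self (μ : Measure ℝ) {s : Set ℝ} (hs : MeasurableSet s) :
    totalExitLaw s μ s = 0 := by
  rw [totalExitLaw, Measure.sum_apply _ hs]
  simp [exitLaw_apply_self μ hs]

/-- The Wiener–Hopf factorization of the step law, with its negative terms moved across. -/
theorem totalExitLaw_add_totalExitLaw_compl (μ : Measure ℝ) [IsFiniteMeasure μ] {s : Set ℝ}
    (hs : MeasurableSet s) (hadd : ∀ x ∈ s, ∀ y ∈ s, x + y ∈ s)
    (hadd' : ∀ x ∈ sᶜ, ∀ y ∈ sᶜ, x + y ∈ sᶜ) :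
    totalExitLaw s μ + totalExitLaw sᶜ μ = μ + totalExitLaw s μ ∗ totalExitLaw sᶜ μ := by
  have h1 : Measure.sum (fun n : ℕ => if n = 1 then μ else 0) = μ := by
    ext t ht
    rw [Measure.sum_apply _ ht, tsum_eq_single 1 (by intro n hn; simp [hn])]
    simp
  rw [totalExitLaw, totalExitLaw, sum_conv_sum, Measure.sum_add_sum]
  nth_rw 3 [← h1]
  rw [Measure.sum_add_sum]
  simp only [exitLaw_add_exitLaw_compl μ hs hadd hadd']

/-- A partial sum of a Cauchy product whose factors have no terms of index `0` is bounded by the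
product of shorter partial sums. -/
theorem sum_range_succ_antidiagonal_conv_le (m k : ℕ → Measure ℝ) [∀ i, IsFiniteMeasure (m i)]
    [∀ i, IsFiniteMeasure (k i)] (hm : m 0 = 0) (hk : k 0 = 0) (N : ℕ) :
    ∑ n ∈ Finset.range (N + 1), ∑ p ∈ antidiagonal n, m p.1 ∗ k p.2 ≤
      (∑ i ∈ Finset.range N, m i) ∗ (∑ i ∈ Finset.range N, k i) := by
  have htrunc (j : ℕ → Measure ℝ) :
      ∑ i ∈ Finset.range N, j i = Measure.sum fun i => if i < N then j i else 0 := by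
    ext t ht
    rw [Measure.sum_apply _ ht, Measure.finsetSum_apply,
      tsum_eq_sum (s := Finset.range N) (by
        intro i hi
        rw [if_neg (by simpa using hi), Measure.coe_zero, Pi.zero_apply])]
    refine Finset.sum_congr rfl fun i hi => ?_
    rw [if_pos (Finset.mem_range.1 hi)]
  have hfin (j : ℕ → Measure ℝ) [∀ i, IsFiniteMeasure (j i)] (i : ℕ) :
      IsFiniteMeasure (if i < N then j i else 0) := by
    split_ifs <;> infer_instance
  have := hfin m
  have := hfin k
  rw [htrunc m, htrunc k, sum_conv_sum]
  have heq : ∑ n ∈ Finset.range (N + 1), ∑ p ∈ antidiagonal n, m p.1 ∗ k p.2 =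
      ∑ n ∈ Finset.range (N + 1), ∑ p ∈ antidiagonal n,
        (if p.1 < N then m p.1 else 0) ∗ (if p.2 < N then k p.2 else 0) := by
    refine Finset.sum_congr rfl fun n hn => Finset.sum_congr rfl fun p hp => ?_
    have hpn := Finset.HasAntidiagonal.mem_antidiagonal.1 hp
    have hnN := Finset.mem_range.1 hn
    -- A factor with index `N` is paired with one of index `0`, which vanishes.
    by_cases h1 : p.1 < N
    · by_cases h2 : p.2 < N
      · rw [if_pos h1, if_pos h2]
      · have : p.1 = 0 := by omega
        simp [this, hm]
    · have : p.2 = 0 := by omega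
      simp [this, hk]
  rw [heq]
  refine Measure.le_iff.2 fun t ht => ?_
  rw [Measure.finsetSum_apply, Measure.sum_apply _ ht]
  exact ENNReal.sum_le_tsum _

theorem le_of_add_le_add_of_null {a b c d : Measure ℝ} {s : Set ℝ}
    (ha : a s = 0) (hd : d sᶜ = 0) (h : a + b ≤ c + d) : a ≤ c := by
  refine Measure.le_iff.2 fun t ht => ?_
  rw [← measure_sdiff_null ha]
  calc a (t \ s) ≤ (a + b) (t \ s) := by simp
    _ ≤ (c + d) (t \ s) := h _
    _ = c (t \ s) := by
      rw [Measure.add_apply, measure_mono_null (fun x hx => hx.2) hd, add_zero]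
    _ ≤ c t := measure_mono Set.sdiff_subset

/-- The exit laws are the smallest solution of the Wiener–Hopf equation: their partial sums are
bounded by any other solution, by induction on the number of terms. -/
theorem totalExitLaw_le (μ : Measure ℝ) [IsFiniteMeasure μ] {s : Set ℝ}
    (hs : MeasurableSet s) (hadd : ∀ x ∈ s, ∀ y ∈ s, x + y ∈ s)
    (hadd' : ∀ x ∈ sᶜ, ∀ y ∈ sᶜ, x + y ∈ sᶜ) {ν ν' : Measure ℝ} [IsFiniteMeasure ν]
    [IsFiniteMeasure ν'] (hν : ν s = 0) (hν' : ν' sᶜ = 0) (h : μ + ν ∗ ν' = ν + ν') :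
    totalExitLaw s μ ≤ ν ∧ totalExitLaw sᶜ μ ≤ ν' := by
  have hfinite (N : ℕ) : ∑ i ∈ Finset.range N, exitLaw s μ i ≤ ν ∧
      ∑ i ∈ Finset.range N, exitLaw sᶜ μ i ≤ ν' := by
    induction N with
    | zero => simp [Measure.zero_le]
    | succ N ih =>
      have h1 : ∑ n ∈ Finset.range (N + 1), (if n = 1 then μ else 0) ≤ μ := by
        rw [Finset.sum_ite_eq']
        split_ifs
        · exact le_rfl
        · exact Measure.zero_le _
      have hle : ∑ i ∈ Finset.range (N + 1), exitLaw s μ i +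
          ∑ i ∈ Finset.range (N + 1), exitLaw sᶜ μ i ≤ ν + ν' := by
        rw [← Finset.sum_add_distrib]
        simp only [exitLaw_add_exitLaw_compl μ hs hadd hadd']
        rw [Finset.sum_add_distrib, ← h]
        exact add_le_add h1 ((sum_range_succ_antidiagonal_conv_le _ _ rfl rfl N).trans
          (conv_mono ih.1 ih.2))
      have hz {t : Set ℝ} (ht : MeasurableSet t) :
          (∑ i ∈ Finset.range (N + 1), exitLaw t μ i) t = 0 := by
        rw [Measure.finsetSum_apply]
        exact Finset.sum_eq_zero fun i _ => exitLaw_apply_self μ ht i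
      refine ⟨le_of_add_le_add_of_null (hz hs) hν' hle, ?_⟩
      rw [add_comm, add_comm ν] at hle
      exact le_of_add_le_add_of_null (hz hs.compl) (by rwa [compl_compl]) hle
  have hsup {m : ℕ → Measure ℝ} {k : Measure ℝ} (hk : ∀ N, ∑ i ∈ Finset.range N, m i ≤ k) :
      Measure.sum m ≤ k := by
    refine Measure.le_iff.2 fun t ht => ?_
    rw [Measure.sum_apply _ ht]
    refine ENNReal.tsum_le_of_sum_range_le fun N => ?_
    rw [← Measure.finsetSum_apply]
    exact hk N t
  exact ⟨hsup fun N => (hfinite N).1, hsup fun N => (hfinite N).2⟩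

/-- Uniqueness of the Wiener–Hopf factorization of a step law other than `δ₀`. -/
theorem eq_totalExitLaw (μ : Measure ℝ) [IsProbabilityMeasure μ] (hμ : μ ≠ Measure.dirac 0)
    {ν ν' : Measure ℝ} [IsFiniteMeasure ν] [IsFiniteMeasure ν'] (hν1 : ν Set.univ ≤ 1)
    (hν1' : ν' Set.univ ≤ 1) (hν : ν (Set.Iic 0) = 0) (hν' : ν' (Set.Ioi 0) = 0)
    (h : μ + ν ∗ ν' = ν + ν') :
    ν = totalExitLaw (Set.Iic 0) μ ∧ ν' = totalExitLaw (Set.Ioi 0) μ := by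
  have hs : MeasurableSet (Set.Iic (0 : ℝ)) := measurableSet_Iic
  have hadd : ∀ x ∈ Set.Iic (0 : ℝ), ∀ y ∈ Set.Iic (0 : ℝ), x + y ∈ Set.Iic (0 : ℝ) :=
    fun x hx y hy => add_nonpos (Set.mem_Iic.1 hx) (Set.mem_Iic.1 hy)
  have hadd' : ∀ x ∈ (Set.Iic (0 : ℝ))ᶜ, ∀ y ∈ (Set.Iic (0 : ℝ))ᶜ,
      x + y ∈ (Set.Iic (0 : ℝ))ᶜ := by
    simpa using fun x hx y hy => add_pos hx hy
  rw [← Set.compl_Iic] at hν' ⊢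
  obtain ⟨hle, hle'⟩ := totalExitLaw_le μ hs hadd hadd' hν hν' h
  have hη := totalExitLaw_add_totalExitLaw_compl μ hs hadd hadd'
  have hη0 := totalExitLaw_apply_self μ hs
  have hη0' := totalExitLaw_apply_self μ hs.compl
  generalize totalExitLaw (Set.Iic 0) μ = η at *
  generalize totalExitLaw (Set.Iic 0)ᶜ μ = η' at *
  have : IsFiniteMeasure η := isFiniteMeasure_of_le ν hle
  have : IsFiniteMeasure η' := isFiniteMeasure_of_le ν' hle'
  have hmass : η.real Set.univ + η'.real Set.univ = 1 + η.real Set.univ * η'.real Set.univ := by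
    have := congrArg (fun m : Measure ℝ => m.real Set.univ) hη
    rw [measureReal_add_apply, measureReal_add_apply] at this
    rw [this, probReal_univ, measureReal_def (η ∗ η'), conv_apply_univ, ENNReal.toReal_mul,
      ← measureReal_def, ← measureReal_def]
  have hfact : (η.real Set.univ - 1) * (η'.real Set.univ - 1) = 0 := by
    linear_combination -hmass
  have hprob {m : Measure ℝ} [IsFiniteMeasure m] (hm : m.real Set.univ - 1 = 0) :
      IsProbabilityMeasure m := by
    rw [sub_eq_zero, measureReal_def, ENNReal.toReal_eq_one_iff] at hm
    exact ⟨hm⟩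
  rcases mul_eq_zero.1 hfact with h1 | h1
  -- A factor of mass one agrees with the one dominating it; the other is then determined.
  · have := hprob h1
    have hνη : η = ν := Measure.eq_of_le_of_measure_univ_le hle (by simpa using hν1)
    subst hνη
    refine ⟨rfl, (eq_of_add_conv_eq hle' hη.symm h fun θ _ hθ => ?_).symm⟩
    refine eq_zero_of_conv_eq_self_of_measure_Iio hθ ?_
      (measure_mono_null Set.Iio_subset_Iic_self hη0)
    rintro rfl
    simp at hη0
  · have := hprob h1
    have hνη : η' = ν' := Measure.eq_of_le_of_measure_univ_le hle' (by simpa using hν1')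
    subst hνη
    rw [Measure.conv_comm, add_comm _ η'] at h hη
    refine ⟨(eq_of_add_conv_eq hle hη.symm h fun θ _ hθ => ?_).symm, rfl⟩
    rw [Set.compl_Iic] at hη0'
    refine eq_zero_of_conv_eq_self_of_measure_Ioi hθ ?_ hη0'
    rintro rfl
    -- If `η' = δ₀` the factorization reads `δ₀ + η = μ + η`.
    rw [Measure.dirac_zero_conv, add_comm] at hη
    exact hμ (Measure.add_left_cancel_of_isFinite (m := η) (by rw [add_comm, ← hη, add_comm]))

/-! ### Defective random variables -/

theorem measurableEmbedding_some {α : Type*} [MeasurableSpace α] :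
    MeasurableEmbedding (some : α → Option α) where
  injective := Option.some_injective α
  measurable := fun _ h => h
  measurableSet_image' := fun t ht => by
    change MeasurableSet (some ⁻¹' (some '' t))
    rwa [Set.preimage_image_eq _ (Option.some_injective α)]

theorem measurable_option_iff {α β : Type*} [MeasurableSpace α] [MeasurableSpace β]
    {f : Option α → β} : Measurable f ↔ Measurable fun x => f (some x) :=
  ⟨fun h => h.comp measurableEmbedding_some.measurable, fun h _ ht => h ht⟩

/-- Every measurable set of `α ∪ {Δ}`, or else its complement, is a measurable subset of `α`. -/
theorem Option.exists_image_some_eq_or_compl {α : Type*} [MeasurableSpace α] {t : Set (Option α)}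
    (ht : MeasurableSet t) :
    ∃ u : Set α, MeasurableSet u ∧ (t = some '' u ∨ tᶜ = some '' u) := by
  have key {t : Set (Option α)} (h : none ∉ t) : t = some '' (some ⁻¹' t) := by
    ext (_ | x) <;> simp [h]
  by_cases h : none ∈ t
  · exact ⟨some ⁻¹' tᶜ, measurableEmbedding_some.measurable ht.compl, .inr (key (by simpa using h))⟩
  · exact ⟨some ⁻¹' t, measurableEmbedding_some.measurable ht, .inl (key h)⟩

/-- Two laws on `α ∪ {Δ}` that agree on `α` give the same mass to `Δ`. -/
theorem MeasureTheory.Measure.ext_of_comap_some {α : Type*} [MeasurableSpace α]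
    {m k : Measure (Option α)} [IsProbabilityMeasure m] [IsProbabilityMeasure k]
    (h : m.comap some = k.comap some) : m = k := by
  have him {u : Set α} : m (some '' u) = k (some '' u) := by
    rw [← measurableEmbedding_some.comap_apply, h, measurableEmbedding_some.comap_apply]
  ext t ht
  obtain ⟨u, -, rfl | hu⟩ := Option.exists_image_some_eq_or_compl ht
  · exact him
  · rw [← compl_compl t, hu, prob_compl_eq_one_sub (hu ▸ ht.compl),
      prob_compl_eq_one_sub (hu ▸ ht.compl), him]

theorem measurable_to_option {α Ω : Type*} [MeasurableSpace α] [MeasurableSpace Ω]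
    {V : Ω → Option α} (h : ∀ u, MeasurableSet u → MeasurableSet (V ⁻¹' (some '' u))) :
    Measurable V := by
  intro t ht
  obtain ⟨u, hu, rfl | hut⟩ := Option.exists_image_some_eq_or_compl ht
  · exact h u hu
  · rw [← compl_compl t, hut, Set.preimage_compl]
    exact (h u hu).compl

theorem measurable_optionMap {α β : Type*} [MeasurableSpace α] [MeasurableSpace β] {f : α → β}
    (hf : Measurable f) : Measurable (Option.map f) :=
  measurable_option_iff.2 (measurableEmbedding_some.measurable.comp hf)

theorem charFun_comap_some_map {Ω : Type*} [MeasurableSpace Ω] (P : Measure Ω)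
    {V : Ω → Option ℝ} (hV : Measurable V) (z : ℝ) :
    charFun ((P.map V).comap some) z = defectiveCharFun P V z := by
  have hm : Measurable (extendByZero fun x => Complex.exp (Complex.I * (z : ℂ) * (x : ℂ))) :=
    measurable_option_iff.2 (by simp only [extendByZero]; fun_prop)
  rw [defectiveCharFun, ← integral_map hV.aemeasurable hm.aestronglyMeasurable,
    ← setIntegral_eq_integral_of_forall_compl_eq_zero (s := Set.range some),
    ← measurableEmbedding_some.map_comap, measurableEmbedding_some.integral_map, charFun_apply_real]
  · refine integral_congr_ae (ae_of_all _ fun x => ?_)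
    simp only [extendByZero]
    ring_nf
  · rintro (_ | x) hx
    · rfl
    · simp at hx

/-- The convention `f Δ = 0` is compatible with reflecting the finite values and keeping `Δ`. -/
theorem defectiveCharFun_optionMap_neg {Ω : Type*} [MeasurableSpace Ω] (P : Measure Ω)
    (V : Ω → Option ℝ) (z : ℝ) :
    defectiveCharFun P (fun ω => (V ω).map Neg.neg) z = defectiveCharFun P V (-z) := by
  unfold defectiveCharFun
  congr 1
  ext ω
  cases h : V ω <;> simp [extendByZero, h]

/-! ### The random walk at its first exit -/

namespace IsRandomWalk

variable {Ω : Type*} [MeasurableSpace Ω] {P : Measure Ω} {X : ℕ → Ω → ℝ}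

theorem measurableSet_forall_mem (hX : IsRandomWalk P X) {s : Set ℝ} (hs : MeasurableSet s)
    (n : ℕ) : MeasurableSet {ω | ∀ j, 1 ≤ j → j ≤ n → X j ω ∈ s} := by
  simp only [Set.ofPred_forall]
  exact .iInter fun j => .iInter fun _ => .iInter fun _ => hX.measurable j hs

/-- The increment after time `n` is independent of the position at time `n` on the event of
survival in `s` up to time `n`. -/
theorem map_restrict_prodMk_increment [IsProbabilityMeasure P]
    (hX : IsRandomWalk P X) {s : Set ℝ} (hs : MeasurableSet s)
    (n : ℕ) :
    (P.restrict {ω | ∀ j, 1 ≤ j → j ≤ n → X j ω ∈ s}).map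
        (fun ω => (X n ω, X (n + 1) ω - X n ω)) =
      ((P.restrict {ω | ∀ j, 1 ≤ j → j ≤ n → X j ω ∈ s}).map (X n)).prod (P.map (X 1)) := by
  have hmX := hX.measurable
  symm
  refine Measure.prod_eq fun A B hA hB => ?_
  rw [Measure.map_apply (by fun_prop) (hA.prod hB), Measure.map_apply (hmX n) hA,
    ← (hX.identDistrib n).map_eq, Measure.map_apply (by fun_prop) hB,
    Measure.restrict_apply (hmX n hA), Measure.restrict_apply]
  swap
  · exact (show Measurable fun ω => (X n ω, X (n + 1) ω - X n ω) by fun_prop) (hA.prod hB)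
  -- The path up to time `n` as a function of the first `n` increments.
  let path (y : Finset.range n → ℝ) (j : ℕ) : ℝ := ∑ i, if i.1 < j then y i else 0
  have hpath : ∀ᵐ ω ∂P, ∀ j ≤ n, path (fun i => X (i.1 + 1) ω - X i.1 ω) j = X j ω := by
    filter_upwards [hX.zero] with ω h0 j hj
    simp only [path]
    rw [Finset.sum_coe_sort (Finset.range n)
      (fun i => if i < j then X (i + 1) ω - X i ω else 0), ← Finset.sum_filter]
    have : (Finset.range n).filter (· < j) = Finset.range j := by ext; simp; omega
    rw [this, Finset.sum_range_sub (fun i => X i ω), h0, sub_zero]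
  have hmpath (j : ℕ) : Measurable fun y => path y j :=
    Finset.measurable_sum _ fun i _ => by
      split_ifs
      · exact measurable_pi_apply i
      · exact measurable_const
  let T : Set (Finset.range n → ℝ) :=
    {y | (∀ j, 1 ≤ j → j ≤ n → path y j ∈ s) ∧ path y n ∈ A}
  have hT : MeasurableSet T := by
    refine .inter (s₁ := {y | ∀ j, 1 ≤ j → j ≤ n → path y j ∈ s}) ?_ (hmpath n hA)
    simp only [Set.ofPred_forall]
    exact .iInter fun j => .iInter fun _ => .iInter fun _ => hmpath j hs
  have hcongr : (X n ⁻¹' A ∩ {ω | ∀ j, 1 ≤ j → j ≤ n → X j ω ∈ s} : Set Ω) =ᵐ[P]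
      (fun ω (i : Finset.range n) => X (i.1 + 1) ω - X i.1 ω) ⁻¹' T := by
    refine Filter.eventuallyEq_set.2 ?_
    filter_upwards [hpath] with ω hω
    simp only [Set.mem_inter_iff, Set.mem_preimage, Set.mem_ofPred_eq, T, hω n le_rfl]
    rw [and_comm]
    refine and_congr_left fun _ => forall_congr' fun j => forall_congr' fun _ =>
      forall_congr' fun hj => ?_
    rw [hω j hj]
  have hindep := ((hX.indep.indepFun_finset (Finset.range n) {n} (by simp)
    (fun i => by fun_prop)).comp measurable_id
    (measurable_pi_apply ⟨n, Finset.mem_singleton_self n⟩)).measure_inter_preimage_eq_mul T B hT hB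
  have hcongr' := measure_congr
    (hcongr.inter (ae_eq_refl ((fun ω => X (n + 1) ω - X n ω) ⁻¹' B)))
  rw [measure_congr hcongr]
  refine Eq.trans ?_ (hcongr'.trans hindep)
  congr 1
  ext ω
  simp only [Set.mem_inter_iff, Set.mem_preimage, Set.mem_prod]
  tauto

theorem map_restrict_succ_of_map_restrict [IsProbabilityMeasure P]
    (hX : IsRandomWalk P X) {s : Set ℝ}
    (hs : MeasurableSet s) (n : ℕ) :
    (P.restrict {ω | ∀ j, 1 ≤ j → j ≤ n → X j ω ∈ s}).map (X (n + 1)) =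
      (P.restrict {ω | ∀ j, 1 ≤ j → j ≤ n → X j ω ∈ s}).map (X n) ∗ P.map (X 1) := by
  have hmX := hX.measurable
  rw [Measure.conv, ← hX.map_restrict_prodMk_increment hs n,
    Measure.map_map (by fun_prop) (by fun_prop)]
  congr 1
  ext ω
  simp

theorem map_restrict_eq_killedLaw [IsProbabilityMeasure P]
    (hX : IsRandomWalk P X) {s : Set ℝ} (hs : MeasurableSet s)
    (n : ℕ) :
    (P.restrict {ω | ∀ j, 1 ≤ j → j ≤ n → X j ω ∈ s}).map (X n) =
      killedLaw s (P.map (X 1)) n := by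
  induction n with
  | zero =>
    have : {ω | ∀ j, 1 ≤ j → j ≤ 0 → X j ω ∈ s} = Set.univ := by
      ext ω
      simp only [Set.mem_ofPred_eq, Set.mem_univ, iff_true]
      omega
    rw [this, Measure.restrict_univ, killedLaw, Measure.map_congr (g := fun _ => 0) hX.zero,
      Measure.map_const]
    simp
  | succ n ih =>
    rw [killedLaw, ← ih, ← hX.map_restrict_succ_of_map_restrict hs,
      Measure.restrict_map (hX.measurable _) hs, Measure.restrict_restrict (hX.measurable _ hs)]
    congr 2
    ext ω
    simp only [Set.mem_ofPred_eq, Set.mem_inter_iff, Set.mem_preimage]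
    constructor
    · exact fun h => ⟨h _ (by omega) le_rfl, fun j h1 hj => h j h1 (by omega)⟩
    · rintro ⟨h1, h2⟩ j hj1 hj2
      rcases Nat.le_succ_iff.1 hj2 with h | rfl
      · exact h2 j hj1 h
      · exact h1

theorem measure_eq_exitLaw_succ [IsProbabilityMeasure P]
    (hX : IsRandomWalk P X) {s : Set ℝ} (hs : MeasurableSet s)
    (n : ℕ) {B : Set ℝ} (hB : MeasurableSet B) :
    P (X (n + 1) ⁻¹' (B ∩ sᶜ) ∩ {ω | ∀ j, 1 ≤ j → j ≤ n → X j ω ∈ s}) =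
      exitLaw s (P.map (X 1)) (n + 1) B := by
  rw [exitLaw, ← hX.map_restrict_eq_killedLaw hs, ← hX.map_restrict_succ_of_map_restrict hs,
    Measure.restrict_apply hB, Measure.map_apply (hX.measurable _) (hB.inter hs.compl),
    Measure.restrict_apply (hX.measurable _ (hB.inter hs.compl))]

end IsRandomWalk

open scoped Classical in
/-- The position of the process `X` when it first exits `s` after time `0`, and `Δ` if it never
does. -/
noncomputable def exitPosition {Ω : Type*} (X : ℕ → Ω → ℝ) (s : Set ℝ) (ω : Ω) : Option ℝ :=
  if hittingAfter X sᶜ 1 ω = ⊤ then none else some (stoppedValue X (hittingAfter X sᶜ 1) ω)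

theorem exitPosition_preimage_image_some {Ω : Type*} (X : ℕ → Ω → ℝ) (s B : Set ℝ) :
    exitPosition X s ⁻¹' (some '' B) =
      ⋃ n, X (n + 1) ⁻¹' (B ∩ sᶜ) ∩ {ω | ∀ j, 1 ≤ j → j ≤ n → X j ω ∈ s} := by
  ext ω
  simp only [Set.mem_preimage, Set.mem_iUnion, Set.mem_inter_iff, Set.mem_ofPred_eq, exitPosition,
    stoppedValue]
  constructor
  · split_ifs with h
    · simp
    · rintro ⟨x, hx, hxe⟩
      obtain rfl := Option.some.inj hxe
      have hmem := hittingAfter_mem_set_of_ne_top h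
      have h1 := le_hittingAfter (u := X) (s := sᶜ) (n := 1) ω
      have hlt := fun k => notMem_of_lt_hittingAfter (u := X) (s := sᶜ) (n := 1) (ω := ω) (k := k)
      generalize hittingAfter X sᶜ 1 ω = τ at *
      lift τ to ℕ using h
      change X τ ω ∈ _ at hx hmem
      have h1' : 1 ≤ τ := by exact_mod_cast h1
      obtain ⟨n, rfl⟩ := Nat.exists_eq_add_of_le' h1'
      refine ⟨n, ⟨hx, hmem⟩, fun j hj1 hj2 => ?_⟩
      have := hlt j (by exact_mod_cast Nat.lt_succ_of_le hj2) hj1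
      simpa using this
  · rintro ⟨n, ⟨hB, hs⟩, hj⟩
    have hτ : hittingAfter X sᶜ 1 ω = WithTop.some (n + 1) := by
      refine le_antisymm (hittingAfter_le_of_mem (Nat.le_add_left 1 n) hs) (not_lt.1 fun hlt => ?_)
      obtain ⟨j, ⟨hj1, hj2⟩, hjs⟩ := hittingAfter_lt_iff.1 hlt
      exact hjs (hj j hj1 (Nat.lt_succ_iff.1 hj2))
    rw [hτ, if_neg WithTop.coe_ne_top]
    exact ⟨_, hB, rfl⟩

namespace IsRandomWalk

variable {Ω : Type*} [MeasurableSpace Ω] {P : Measure Ω} {X : ℕ → Ω → ℝ}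

theorem measurable_exitPosition (hX : IsRandomWalk P X) {s : Set ℝ} (hs : MeasurableSet s) :
    Measurable (exitPosition X s) :=
  measurable_to_option fun u hu => by
    rw [exitPosition_preimage_image_some]
    exact .iUnion fun n => (hX.measurable _ (hu.inter hs.compl)).inter
      (hX.measurableSet_forall_mem hs n)

theorem comap_some_map_exitPosition [IsProbabilityMeasure P]
    (hX : IsRandomWalk P X) {s : Set ℝ} (hs : MeasurableSet s) :
    (P.map (exitPosition X s)).comap some = totalExitLaw s (P.map (X 1)) := by
  ext B hB
  rw [measurableEmbedding_some.comap_apply, Measure.map_apply (hX.measurable_exitPosition hs)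
    (measurableEmbedding_some.measurableSet_image' hB), exitPosition_preimage_image_some,
    measure_iUnion, totalExitLaw, Measure.sum_apply _ hB, 
    tsum_eq_zero_add' (f := fun n => exitLaw s (P.map (X 1)) n B) ENNReal.summable]
  · have h0 : exitLaw s (P.map (X 1)) 0 B = 0 := rfl
    simp only [hX.measure_eq_exitLaw_succ hs _ hB, h0, zero_add]
  · intro n m hnm
    wlog h : n < m generalizing n m
    · exact (this hnm.symm (by omega)).symm
    refine Set.disjoint_left.2 fun ω hn hm => ?_
    exact hn.1.2 (hm.2 (n + 1) (by omega) h)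
  · exact fun n => (hX.measurable _ (hB.inter hs.compl)).inter (hX.measurableSet_forall_mem hs n)

end IsRandomWalk

theorem strictAscendingHeight_eq_exitPosition {Ω : Type*} (X : ℕ → Ω → ℝ) :
    strictAscendingHeight X = exitPosition X (Set.Iic 0) := by
  ext1 ω
  rw [strictAscendingHeight, exitPosition, Set.compl_Iic, strictAscendingTime]

theorem weakDescendingHeight_eq_exitPosition {Ω : Type*} (X : ℕ → Ω → ℝ) :
    weakDescendingHeight X = fun ω => (exitPosition X (Set.Ioi 0) ω).map Neg.neg := by
  ext1 ω
  rw [weakDescendingHeight, exitPosition, Set.compl_Ioi, weakDescendingTime]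
  split_ifs <;> rfl

/-! ### Uniqueness for defective random variables -/

theorem comap_some_map_apply_eq_zero {Ω : Type*} [MeasurableSpace Ω] {P : Measure Ω}
    {V : Ω → Option ℝ} (hV : Measurable V) {s : Set ℝ} (hs : MeasurableSet s)
    (h : ∀ᵐ ω ∂P, ∀ x ∈ V ω, x ∉ s) : (P.map V).comap some s = 0 := by
  rw [measurableEmbedding_some.comap_apply,
    Measure.map_apply hV (measurableEmbedding_some.measurableSet_image' hs),
    measure_eq_zero_iff_ae_notMem]
  filter_upwards [h] with ω hω
  rintro ⟨x, hx, hxe⟩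
  exact hω x hxe.symm hx

theorem comap_some_map_univ_le_one {Ω : Type*} [MeasurableSpace Ω] {P : Measure Ω}
    [IsProbabilityMeasure P] {V : Ω → Option ℝ} (hV : Measurable V) :
    (P.map V).comap some Set.univ ≤ 1 := by
  have := Measure.isProbabilityMeasure_map (μ := P) hV.aemeasurable
  rw [measurableEmbedding_some.comap_apply]
  exact prob_le_one

theorem identDistrib_of_comap_some_map_eq {Ω Ω' : Type*} [MeasurableSpace Ω] [MeasurableSpace Ω']
    {P : Measure Ω} {P' : Measure Ω'} [IsProbabilityMeasure P] [IsProbabilityMeasure P']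
    {V : Ω → Option ℝ} {V' : Ω' → Option ℝ} (hV : Measurable V) (hV' : Measurable V')
    (h : (P.map V).comap some = (P'.map V').comap some) : IdentDistrib V V' P P' := by
  have := Measure.isProbabilityMeasure_map (μ := P) hV.aemeasurable
  have := Measure.isProbabilityMeasure_map (μ := P') hV'.aemeasurable
  exact ⟨hV.aemeasurable, hV'.aemeasurable, Measure.ext_of_comap_some h⟩

theorem theorem3
    {Ω Ω₁ Ω₂ : Type*} [MeasurableSpace Ω] [MeasurableSpace Ω₁] [MeasurableSpace Ω₂]
    (P : Measure Ω) [IsProbabilityMeasure P]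
    (P₁ : Measure Ω₁) [IsProbabilityMeasure P₁]
    (P₂ : Measure Ω₂) [IsProbabilityMeasure P₂]
    (X : ℕ → Ω → ℝ) (hX : IsRandomWalk P X) (hX1 : ¬ ∀ᵐ ω ∂P, X 1 ω = 0)
    (Vp : Ω₁ → Option ℝ) (hVp : Measurable Vp) (hVp_pos : ∀ᵐ ω ∂P₁, ∀ x ∈ Vp ω, 0 < x)
    (Vm : Ω₂ → Option ℝ) (hVm : Measurable Vm) (hVm_nonneg : ∀ᵐ ω ∂P₂, ∀ x ∈ Vm ω, 0 ≤ x)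
    (hfact : ∀ z : ℝ,
      1 - ∫ ω, Complex.exp (Complex.I * (z : ℂ) * (X 1 ω : ℂ)) ∂P =
        (1 - defectiveCharFun P₁ Vp z) * (1 - defectiveCharFun P₂ Vm (-z))) :
    IdentDistrib Vp (strictAscendingHeight X) P₁ P ∧
      IdentDistrib Vm (weakDescendingHeight X) P₂ P := by
  have hmneg : Measurable (Option.map (Neg.neg : ℝ → ℝ)) := measurable_optionMap measurable_neg
  have hmX1 := hX.measurable 1
  -- The descending factor is handled as the position `-V⁻`, a point of the lower half-line.
  let W : Ω₂ → Option ℝ := fun ω => (Vm ω).map Neg.neg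
  have hW : Measurable W := hmneg.comp hVm
  have hμ : IsProbabilityMeasure (P.map (X 1)) := Measure.isProbabilityMeasure_map hmX1.aemeasurable
  have hμ0 : P.map (X 1) ≠ Measure.dirac 0 := fun h => hX1 <| by
    refine ae_of_ae_map hmX1.aemeasurable (p := fun x => x = 0) ?_
    rw [h]
    exact (ae_dirac_iff (measurableSet_singleton (0 : ℝ))).2 rfl
  have hcharX (z : ℝ) : charFun (P.map (X 1)) z =
      ∫ ω, Complex.exp (Complex.I * (z : ℂ) * (X 1 ω : ℂ)) ∂P := by
    rw [charFun_apply_real, integral_map hmX1.aemeasurable (by fun_prop)]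
    refine integral_congr_ae (ae_of_all _ fun ω => ?_)
    ring_nf
  have hν1 := comap_some_map_univ_le_one (P := P₁) hVp
  have hν1' := comap_some_map_univ_le_one (P := P₂) hW
  have : IsFiniteMeasure ((P₁.map Vp).comap some) := ⟨hν1.trans_lt ENNReal.one_lt_top⟩
  have : IsFiniteMeasure ((P₂.map W).comap some) := ⟨hν1'.trans_lt ENNReal.one_lt_top⟩
  have hconv : P.map (X 1) + (P₁.map Vp).comap some ∗ (P₂.map W).comap some =
      (P₁.map Vp).comap some + (P₂.map W).comap some := by
    apply Measure.ext_of_charFun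
    rw [charFun_add_measure, charFun_add_measure, charFun_conv_eq_mul]
    ext z
    simp only [Pi.add_apply, Pi.mul_apply, charFun_comap_some_map _ hVp,
      charFun_comap_some_map _ hW, W, defectiveCharFun_optionMap_neg, hcharX]
    linear_combination -hfact z
  obtain ⟨h, h'⟩ := eq_totalExitLaw (P.map (X 1)) hμ0 hν1 hν1'
    (comap_some_map_apply_eq_zero hVp measurableSet_Iic (by simpa using hVp_pos))
    (comap_some_map_apply_eq_zero hW measurableSet_Ioi (by simpa [W] using hVm_nonneg)) hconv
  rw [← hX.comap_some_map_exitPosition measurableSet_Iic] at h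
  rw [← hX.comap_some_map_exitPosition measurableSet_Ioi] at h'
  constructor
  · rw [strictAscendingHeight_eq_exitPosition]
    exact identDistrib_of_comap_some_map_eq hVp (hX.measurable_exitPosition measurableSet_Iic) h
  · have hneg := (identDistrib_of_comap_some_map_eq hW
      (hX.measurable_exitPosition measurableSet_Ioi) h').comp hmneg
    rw [weakDescendingHeight_eq_exitPosition]
    have hVmW : Vm = Option.map Neg.neg ∘ W := by
      ext1 ω
      simp [W]
    rw [hVmW]
    exact hneg
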